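/- **Theorem (Convergence of ADMM).** Let $f:\mathbb R^m\to\mathbb R\cup\{\infty\}$, $g:\mathbb R^n\to\mathbb R\cup\{\infty\}$, $A\in\mathbb R^{p\times m}$, $B\in\mathbb R^{p\times n}$, $b\in\mathbb R^p$, and consider the problem of minimizing $f(x)+g(z)$ subject to $Ax+Bz=b$, with augmented Lagrangian $$\mathcal L_\beta(x,z,y)=f(x)+g(z)+\langle y,Ax+Bz-b\rangle+\tfrac\beta2\|Ax+Bz-b\|^2 .$$ Let $\Phi(x,z)=f(x)+g(z)$ if $Ax+Bz=b$ and $\Phi(x,z)=\infty$ otherwise. For a function $h$ and a matrix $C$ let $(C\triangleright h)(s)=\inf\{h(w): Cw=s\}$. ADMM with penalty $\beta>0$ and relaxation $\lambda>0$ maps $(x,y,z)$ to $(x^+,y^+,z^+)$ with $$y^{+/2}=y-\beta(1-\lambda)(Ax+Bz-b),\quad x^+\in\arg\min\mathcal L_\beta(\cdot,z,y^{+/2}),\quad y^+=y^{+/2}+\beta(Ax^++Bz-b),\quad z^+\in\arg\min\mathcal L_\beta(x^+,\cdot,y^+),$$ where in each minimization the summand that does not depend on the minimization variable is ignored. *Assumptions.*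 $f$ and $g$ are proper and lower semicontinuous (lsc); $A$ is surjective; all ADMM subproblems (for every value of the fixed variables) have solutions; $\varphi_1:=A\triangleright f$ is real valued and continuously differentiable with $L$-Lipschitz gradient, and $\varphi_1-\tfrac\sigma2\|\cdot\|^2$ is convex, where $|\sigma|\le L$; $B\triangleright g$ is lsc; $\Phi$ has a minimizer. *Parameters.* Let $p:=\sigma/L$ ($p:=0$ if $L=0$), $[r]_-:=\max\{0,-r\}$, $1/0:=\infty$, $\beta=1/\gamma$ with $\gamma>0$, and let one of the following hold: 1. $0<\lambda<2$ and $\gamma<\min\bigl\{\tfrac{2-\lambda}{2[\sigma]_-},\tfrac1L\bigr\}$, in which case put $$c=\frac{2-\lambda}{2\lambda\gamma}-\begin{cases}L\max\bigl\{\tfrac{[p]_-}{2(1-[p]_-)},\ \tfrac{\gamma L}\lambda-\tfrac12\bigr\}&\text{if }p\ge\tfrac\lambda2-1,\\ \tfrac{[\sigma]_-}{\lambda}&\text{otherwise;}\end{cases}$$ 2. $\sigma>0$, $2\le\lambda<\tfrac{4}{1+\sqrt{1-p}}$ and $\tfrac{p\lambda-\delta}{4\sigma}<\gamma<\tfrac{p\lambda+\delta}{4\sigma}$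 with $\delta=\sqrt{(p\lambda)^2-8p(\lambda-2)}$, in which case put $$c=\frac{2-\lambda}{2\lambda\gamma}+\sigma\Bigl(\frac12-\frac{\gamma L}{\lambda}\Bigr).$$ Let $(x^k,y^k,z^k)_{k\ge0}$ be generated by ADMM from an arbitrary $(x^{-1},y^{-1},z^{-1})\in\mathbb R^m\times\mathbb R^p\times\mathbb R^n$. Then: (i) $c>0$; $f(x^k)$ and $g(z^k)$ are finite for all $k\ge0$, and $$\mathcal L_\beta(x^{k+1},z^{k+1},y^{k+1})\le\mathcal L_\beta(x^k,z^k,y^k)-\frac{c\lambda^2}{(1+\gamma L)^2}\|Ax^k+Bz^k-b\|^2;$$ the residual $Ax^k+Bz^k-b$ converges to $0$, and $\min_{i\le k}\|Ax^i+Bz^i-b\|=o(1/\sqrt k)$. (ii) $\mathcal L_\beta(x^k,z^k,y^k)$ converges to a finite limit $\ell$, and every cluster point $(x,z,y)$ of $(x^k,z^k,y^k)_k$ satisfies the KKT conditions $-A^\top y\in\partial f(x)$, $-B^\top y\in\partial g(z)$, $Ax+Bz=b$ ($\partial$ is the limiting subdifferential), and $f(x)+g(z)=\ell$. (iii) If $\Phi$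 is level bounded, then $(Ax^k,y^k,Bz^k)_k$ is bounded. If, additionally, $f$ is real valued and continuously differentiable with Lipschitz gradient, then $(x^k,y^k,z^k)_k$ is bounded. -/

import Mathlib

open Filter Topology InnerProductSpace Asymptotics

noncomputable section

namespace ADMM

/-! Euclidean spaces `ℝ^m`, `ℝ^n`, `ℝ^p` appear as `EuclideanSpace ℝ (Fin _)`, matrices as the linear
maps that they represent and transposes as adjoints.  Extended-real-valued functions have values in
`EReal`; properness excludes the value `⊥`. -/

section General

variable {E : Type*}

/-- `h : E → ℝ ∪ {+∞}` with nonempty domain. -/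
def IsProper (h : E → EReal) : Prop :=
  (∀ x, h x ≠ ⊥) ∧ ∃ x, h x ≠ ⊤

/-- The set of global minimizers of `h`. -/
def argminSet (h : E → EReal) : Set E :=
  {x | ∀ w, h x ≤ h w}

/-- All sublevel sets `{h ≤ α}`, `α ∈ ℝ`, are bounded. -/
def LevelBounded [Bornology E] (h : E → EReal) : Prop :=
  ∀ α : ℝ, Bornology.IsBounded {x | h x ≤ (α : EReal)}

/-- The image function (infimal postcomposition) `(C ▹ h)(s) = inf {h x | C x = s}`. -/
def imageFun {F : Type*} (C : E → F) (h : E → EReal) (s : F) : EReal :=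
  ⨅ (x : E) (_ : C x = s), h x

variable [NormedAddCommGroup E] [InnerProductSpace ℝ E]

/-- Regular subgradients: `h x` is finite and `h w ≥ h x + ⟪v, w - x⟫ + o(‖w - x‖)` as `w → x`, i.e.
`liminf_{w → x, w ≠ x} (h w - h x - ⟪v, w - x⟫) / ‖w - x‖ ≥ 0`. -/
def regSubdiff (h : E → EReal) (x : E) : Set E :=
  {v | h x ≠ ⊤ ∧ h x ≠ ⊥ ∧ ∀ ε : ℝ, 0 < ε → ∀ᶠ w in 𝓝 x,
    h x + ((inner ℝ v (w - x) - ε * ‖w - x‖ : ℝ) : EReal) ≤ h w}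

/-- The limiting subdifferential. -/
def limSubdiff (h : E → EReal) (x : E) : Set E :=
  {v | h x ≠ ⊤ ∧ h x ≠ ⊥ ∧ ∃ (xs vs : ℕ → E), (∀ k, vs k ∈ regSubdiff h (xs k)) ∧
    Tendsto xs atTop (𝓝 x) ∧ Tendsto (fun k => h (xs k)) atTop (𝓝 (h x)) ∧
    Tendsto vs atTop (𝓝 v)}

/-- `h ∈ C^{1,1}` with `L`-Lipschitz gradient. -/
def IsSmoothWith [CompleteSpace E] (L : ℝ) (h : E → ℝ) : Prop :=
  ContDiff ℝ 1 h ∧ ∀ x w, ‖gradient h x - gradient h w‖ ≤ L * ‖x - w‖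

/-- `h - (σ/2) ‖·‖²` is convex. -/
def IsHypoconvex (σ : ℝ) (h : E → ℝ) : Prop :=
  ConvexOn ℝ Set.univ (fun x => h x - σ / 2 * ‖x‖ ^ 2)

end General

section Problem

variable {m n p : ℕ}
  (f : EuclideanSpace ℝ (Fin m) → EReal) (g : EuclideanSpace ℝ (Fin n) → EReal)
  (A : EuclideanSpace ℝ (Fin m) →L[ℝ] EuclideanSpace ℝ (Fin p))
  (B : EuclideanSpace ℝ (Fin n) →L[ℝ] EuclideanSpace ℝ (Fin p))
  (b : EuclideanSpace ℝ (Fin p))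

/-- `A x + B z - b`. -/
def residual (x : EuclideanSpace ℝ (Fin m)) (z : EuclideanSpace ℝ (Fin n)) :
    EuclideanSpace ℝ (Fin p) :=
  A x + B z - b

/-- `⟪y, A x + B z - b⟫ + (β/2) ‖A x + B z - b‖²`. -/
def coupling (β : ℝ) (x : EuclideanSpace ℝ (Fin m)) (z : EuclideanSpace ℝ (Fin n))
    (y : EuclideanSpace ℝ (Fin p)) : ℝ :=
  inner ℝ y (residual A B b x z) + β / 2 * ‖residual A B b x z‖ ^ 2

/-- The `β`-augmented Lagrangian `L_β(x, z, y)`. -/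
def augLag (β : ℝ) (x : EuclideanSpace ℝ (Fin m)) (z : EuclideanSpace ℝ (Fin n))
    (y : EuclideanSpace ℝ (Fin p)) : EReal :=
  f x + g z + (coupling A B b β x z y : EReal)

open Classical in
/-- `Φ(x, z) = f x + g z` if `A x + B z = b`, and `+∞` otherwise. -/
def totalCost (q : EuclideanSpace ℝ (Fin m) × EuclideanSpace ℝ (Fin n)) : EReal :=
  if A q.1 + B q.2 = b then f q.1 + g q.2 else ⊤

/-- `argmin L_β(·, z, y)`.  The summand `g z`, constant in `x`, is left out, so that the subproblem
is the intended one also when `g z = +∞` (which only a starting point can produce). -/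
def argminX (β : ℝ) (z : EuclideanSpace ℝ (Fin n)) (y : EuclideanSpace ℝ (Fin p)) :
    Set (EuclideanSpace ℝ (Fin m)) :=
  argminSet (fun x => f x + (coupling A B b β x z y : EReal))

/-- `argmin L_β(x, ·, y)`, without the summand `f x`, constant in `z`. -/
def argminZ (β : ℝ) (x : EuclideanSpace ℝ (Fin m)) (y : EuclideanSpace ℝ (Fin p)) :
    Set (EuclideanSpace ℝ (Fin n)) :=
  argminSet (fun z => g z + (coupling A B b β x z y : EReal))

theorem argminX_eq (β : ℝ) (z : EuclideanSpace ℝ (Fin n)) (y : EuclideanSpace ℝ (Fin p))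
    (h1 : g z ≠ ⊤) (h2 : g z ≠ ⊥) :
    argminX f A B b β z y = argminSet (fun x => augLag f g A B b β x z y) := by
  obtain ⟨r, hr⟩ : ∃ r : ℝ, (r : EReal) = g z := ⟨_, EReal.coe_toReal h1 h2⟩
  ext x
  simp only [argminX, argminSet, augLag, Set.mem_ofPred_eq, ← hr, add_right_comm _ (r : EReal) _,
    (EReal.addLECancellable_coe r).add_le_add_iff_right]

theorem argminZ_eq (β : ℝ) (x : EuclideanSpace ℝ (Fin m)) (y : EuclideanSpace ℝ (Fin p))
    (h1 : f x ≠ ⊤) (h2 : f x ≠ ⊥) :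
    argminZ g A B b β x y = argminSet (fun z => augLag f g A B b β x z y) := by
  obtain ⟨r, hr⟩ : ∃ r : ℝ, (r : EReal) = f x := ⟨_, EReal.coe_toReal h1 h2⟩
  ext z
  simp only [argminZ, argminSet, augLag, Set.mem_ofPred_eq, ← hr, add_assoc (r : EReal),
    (EReal.addLECancellable_coe r).add_le_add_iff_left]

/-- `(x', y', z')` is a possible outcome of one ADMM update with penalty `β` and relaxation `lam`
from `(x, y, z)`; the half update of the multiplier is `y - β (1 - lam) (A x + B z - b)`. -/
def ADMMStep (β lam : ℝ)
    (x : EuclideanSpace ℝ (Fin m)) (y : EuclideanSpace ℝ (Fin p)) (z : EuclideanSpace ℝ (Fin n))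
    (x' : EuclideanSpace ℝ (Fin m)) (y' : EuclideanSpace ℝ (Fin p))
    (z' : EuclideanSpace ℝ (Fin n)) : Prop :=
  ∃ yh : EuclideanSpace ℝ (Fin p),
    yh = y - (β * (1 - lam)) • residual A B b x z ∧
    x' ∈ argminX f A B b β z yh ∧
    y' = yh + β • residual A B b x' z ∧
    z' ∈ argminZ g A B b β x' y'

/-- The standing assumptions on the linearly constrained problem: minimize `f x + g z` subject to
`A x + B z = b`. -/
structure Assumptions (β L σ : ℝ) : Prop where
  f_proper : IsProper f
  f_lsc : LowerSemicontinuous f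
  g_proper : IsProper g
  g_lsc : LowerSemicontinuous g
  A_surjective : Function.Surjective A
  x_solvable : ∀ z y, (argminX f A B b β z y).Nonempty
  z_solvable : ∀ x y, (argminZ g A B b β x y).Nonempty
  abs_sigma_le : |σ| ≤ L
  /-- `A ▹ f` is real valued, `L`-smooth and `σ`-hypoconvex. -/
  image_smooth : ∃ φ : EuclideanSpace ℝ (Fin p) → ℝ,
    (∀ s, imageFun A f s = (φ s : EReal)) ∧ IsSmoothWith L φ ∧ IsHypoconvex σ φ
  image_lsc : LowerSemicontinuous (imageFun B g)
  exists_solution : (argminSet (totalCost f g A B b)).Nonempty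

end Problem

/-- Negative part `[r]₋ = max {0, -r}`. -/
def negPart (r : ℝ) : ℝ := max 0 (-r)

/-- `δ = √((p lam)² - 8 p (lam - 2))` with `p = σ / L`. -/
def delta (L σ lam : ℝ) : ℝ :=
  √((σ / L * lam) ^ 2 - 8 * (σ / L) * (lam - 2))

/-- The admissible stepsizes `γ` and relaxations `lam`.  In the first case, the two products encode
`γ < min {(2 - lam) / (2 [σ]₋), 1 / L}` with the convention `1 / 0 = ∞`. -/
def Admissible (L σ γ lam : ℝ) : Prop :=
  0 < γ ∧
  ((0 < lam ∧ lam < 2 ∧ γ * (2 * negPart σ) < 2 - lam ∧ γ * L < 1) ∨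
   (0 < σ ∧ 2 ≤ lam ∧ lam < 4 / (1 + √(1 - σ / L)) ∧
     (σ / L * lam - delta L σ lam) / (4 * σ) < γ ∧
     γ < (σ / L * lam + delta L σ lam) / (4 * σ)))

open Classical in
/-- The decrease constant `c`, where `p = σ / L` (if `L = 0` then `σ = 0`, and `p = 0`). -/
def decreaseConst (L σ γ lam : ℝ) : ℝ :=
  if lam < 2 then
    (2 - lam) / (2 * lam * γ) -
      (if lam / 2 - 1 ≤ σ / L then
        L * max (negPart (σ / L) / (2 * (1 - negPart (σ / L)))) (γ * L / lam - 1 / 2)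
      else negPart σ / lam)
  else
    (2 - lam) / (2 * lam * γ) + σ * (1 / 2 - γ * L / lam)

end ADMM

end

namespace ADMM

/-! ### Smooth and hypoconvex functions: quadratic bounds and cocoercivity. -/

section Smooth

variable {E : Type*} [NormedAddCommGroup E] [InnerProductSpace ℝ E]

/-! The coupling sees x only through Ax, so an x-step is a minimization in ℝ^p with f replaced by
its smooth image function φ: the iterates satisfy f(x) = φ(Ax) and y = -∇φ(Ax)
(`ADMMStep.eq_and_gradient`). Put u = Ax, v = b - Bz, r = u - v, and let d, e be the increments of u
and ∇φ(u). The multiplier update becomes λr = -(d + γe). With minimality of z, the Lagrangian drops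
by at least a Bregman distance of φ plus (2-λ)/(2λγ)‖d‖² - (γ/λ)‖e‖²; cocoercivity and hypoconvexity
bound this below by c‖d‖² (`bregman_cocoercive`, `Admissible.decreaseConst_mul_le`,
`Admissible.sufficient_decrease`).

Since γL < 1, the Lagrangian majorizes φ(v) + g(z), hence the optimal value. It therefore converges,
and the squared residuals are summable. KKT conditions at cluster points come from smooth minorants
of f and g touching there (`IsTrace.cluster_isKKT`). Boundedness comes from level boundedness at
feasible points built from the iterates. -/

theorem hasGradientAt_of_isSmoothWith [CompleteSpace E] {L : ℝ} {φ : E → ℝ}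
    (h : IsSmoothWith L φ) (u : E) : HasGradientAt φ (gradient φ u) u :=
  (h.1.differentiable one_ne_zero u).hasGradientAt

theorem hasDerivAt_line [CompleteSpace E] {φ : E → ℝ} {u d v : E} {t : ℝ}
    (h : HasGradientAt φ v (u + t • d)) :
    HasDerivAt (fun t : ℝ => φ (u + t • d)) (inner ℝ v d) t := by
  have h1 : HasDerivAt (fun t : ℝ => u + t • d) d t := by
    simpa using ((hasDerivAt_id t).smul_const d).const_add u
  have h2 := h.hasFDerivAt.comp_hasDerivAt t h1
  rwa [toDual_apply_apply] at h2

/-- The descent lemma. -/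
theorem IsSmoothWith.le_quadratic [CompleteSpace E] {L : ℝ} {φ : E → ℝ}
    (h : IsSmoothWith L φ) (u w : E) :
    φ w ≤ φ u + inner ℝ (gradient φ u) (w - u) + L / 2 * ‖w - u‖ ^ 2 := by
  set d := w - u with hd
  -- The gap between φ and its quadratic model along the segment; Cauchy–Schwarz and the Lipschitz
  -- bound make it nonincreasing on [0, 1].
  let q : ℝ → ℝ := fun t =>
    φ (u + t • d) - t * inner ℝ (gradient φ u) d - t ^ 2 * (L / 2 * ‖d‖ ^ 2)
  have hq : ∀ t, HasDerivAt q (inner ℝ (gradient φ (u + t • d)) d - inner ℝ (gradient φ u) d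
      - 2 * t * (L / 2 * ‖d‖ ^ 2)) t := fun t => by
    have h1 := hasDerivAt_line (hasGradientAt_of_isSmoothWith h (u + t • d))
    have h2 := (hasDerivAt_id t).mul_const (inner ℝ (gradient φ u) d)
    have h3 := (hasDerivAt_pow 2 t).mul_const (L / 2 * ‖d‖ ^ 2)
    have h4 := (h1.fun_sub h2).fun_sub h3
    rw [one_mul, pow_one, Nat.cast_ofNat] at h4
    exact h4
  have hanti : AntitoneOn q (Set.Icc 0 1) := by
    refine antitoneOn_of_deriv_nonpos (convex_Icc 0 1)
      (fun t _ => (hq t).continuousAt.continuousWithinAt)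
      (fun t _ => (hq t).differentiableAt.differentiableWithinAt) fun t ht => ?_
    rw [interior_Icc] at ht
    rw [(hq t).deriv, ← inner_sub_left]
    have h1 := real_inner_le_norm (gradient φ (u + t • d) - gradient φ u) d
    have h2 := h.2 (u + t • d) u
    rw [add_sub_cancel_left, norm_smul, Real.norm_of_nonneg ht.1.le] at h2
    nlinarith [mul_le_mul_of_nonneg_right h2 (norm_nonneg d)]
  have h01 := hanti (Set.left_mem_Icc.2 zero_le_one) (Set.right_mem_Icc.2 zero_le_one) zero_le_one
  simp only [q, one_smul, zero_smul, add_zero, one_mul, zero_mul, one_pow, ne_eq,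
    OfNat.ofNat_ne_zero, not_false_eq_true, zero_pow, sub_zero] at h01
  rw [hd, add_sub_cancel, ← hd] at h01
  linarith

/-- The first-order lower bound for hypoconvex functions. -/
theorem IsHypoconvex.quadratic_le [CompleteSpace E] {σ : ℝ} {φ : E → ℝ}
    (h : IsHypoconvex σ φ) {u v : E} (hv : HasGradientAt φ v u) (w : E) :
    φ u + inner ℝ v (w - u) + σ / 2 * ‖w - u‖ ^ 2 ≤ φ w := by
  set d := w - u with hd
  have hconv : ConvexOn ℝ Set.univ (fun t : ℝ => φ (u + t • d) - σ / 2 * ‖u + t • d‖ ^ 2) := by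
    have := ConvexOn.comp_affineMap (AffineMap.lineMap u w) h
    simpa [Function.comp_def, AffineMap.lineMap_apply, hd, add_comm] using this
  have hder : HasDerivAt (fun t : ℝ => φ (u + t • d) - σ / 2 * ‖u + t • d‖ ^ 2)
      (inner ℝ v d - σ / 2 * (2 * inner ℝ u d)) 0 := by
    have h1 : HasDerivAt (fun t : ℝ => u + t • d) d 0 := by
      simpa using ((hasDerivAt_id (0 : ℝ)).smul_const d).const_add u
    have h2 : HasDerivAt (fun t : ℝ => φ (u + t • d)) (inner ℝ v d) 0 :=
      hasDerivAt_line (by simpa using hv)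
    simpa using h2.fun_sub (h1.norm_sq.const_mul (σ / 2))
  have hs := hconv.le_slope_of_hasDerivAt (Set.mem_univ 0) (Set.mem_univ 1) one_pos hder
  simp only [slope_def_field] at hs
  simp [hd] at hs
  have hw : ‖w‖ ^ 2 = ‖u‖ ^ 2 + 2 * inner ℝ u d + ‖d‖ ^ 2 := by
    rw [← norm_add_sq_real, hd, add_sub_cancel]
  rw [hw] at hs
  linarith

/-- An interpolation inequality for smooth hypoconvex functions. -/
theorem bregman_interpolation [CompleteSpace E] {L σ ρ : ℝ} {φ : E → ℝ}
    (hL : IsSmoothWith L φ) (hσ : IsHypoconvex σ φ) (hρσ : ρ ≤ σ) (hρL : ρ < L) (u w : E) :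
    ‖gradient φ w - gradient φ u‖ ^ 2 - 2 * ρ * inner ℝ (gradient φ w - gradient φ u) (w - u) +
        ρ * L * ‖w - u‖ ^ 2 ≤
      2 * (L - ρ) * (φ u - φ w - inner ℝ (gradient φ w) (u - w)) := by
  set e := gradient φ w - gradient φ u with he
  set d := w - u with hd
  have hpos : 0 < L - ρ := sub_pos.2 hρL
  set h : E := (L - ρ)⁻¹ • (e - ρ • d) with hh
  have h1 := hL.le_quadratic u (u + h)
  have h2 := hσ.quadratic_le (hasGradientAt_of_isSmoothWith hL w) (u + h)
  have e1 : u + h - u = h := add_sub_cancel_left u h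
  have e2 : u + h - w = h - d := by rw [hd]; abel
  have e3 : u - w = -d := by rw [hd]; abel
  have eg : gradient φ w = gradient φ u + e := by rw [he]; abel
  rw [e1] at h1
  rw [e2] at h2
  rw [e3, inner_neg_right]
  have h3 : ρ / 2 * ‖h - d‖ ^ 2 ≤ σ / 2 * ‖h - d‖ ^ 2 := by gcongr
  have h4 : e = (L - ρ) • h + ρ • d := by
    rw [hh, smul_inv_smul₀ hpos.ne']; abel
  clear_value e h
  have h5 : ‖h - d‖ ^ 2 = ‖h‖ ^ 2 - 2 * inner ℝ h d + ‖d‖ ^ 2 := norm_sub_sq_real h d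
  rw [inner_sub_right] at h2
  replace h2 := (add_le_add_right h3 _).trans h2
  rw [h5] at h2
  have h6 : inner ℝ (gradient φ w) h = inner ℝ (gradient φ u) h + inner ℝ e h := by
    rw [eg, inner_add_left]
  have h7 : inner ℝ e h = (L - ρ) * ‖h‖ ^ 2 + ρ * inner ℝ h d := by
    rw [h4, inner_add_left, real_inner_smul_left, real_inner_smul_left,
      real_inner_self_eq_norm_sq, real_inner_comm d h]
  have h8 : inner ℝ e d = (L - ρ) * inner ℝ h d + ρ * ‖d‖ ^ 2 := by
    rw [h4, inner_add_left, real_inner_smul_left, real_inner_smul_left,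
      real_inner_self_eq_norm_sq]
  have h9 : ‖e‖ ^ 2 = (L - ρ) * inner ℝ e h + ρ * inner ℝ e d := by
    rw [← real_inner_smul_right, ← real_inner_smul_right, ← inner_add_right, ← h4,
      real_inner_self_eq_norm_sq]
  have h10 : (L - ρ) / 2 * ‖h‖ ^ 2 + ρ / 2 * ‖d‖ ^ 2 ≤
      φ u - φ w + inner ℝ (gradient φ w) d := by
    linarith
  rw [h9, h8, h7]
  nlinarith [mul_le_mul_of_nonneg_left h10 hpos.le]

/-- A cocoercivity-type bound; for `ρ = 0` it is the Baillon--Haddad inequality. -/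
theorem bregman_cocoercive [CompleteSpace E] {L σ ρ : ℝ} {φ : E → ℝ}
    (hL : IsSmoothWith L φ) (hσ : IsHypoconvex σ φ) (hLρ : -L ≤ ρ) (hρ : ρ ≤ 0) (hρσ : ρ ≤ σ)
    (u w : E) :
    ‖gradient φ w - gradient φ u‖ ^ 2 + ρ * L * ‖w - u‖ ^ 2 ≤
      2 * (L + ρ) * (φ u - φ w - inner ℝ (gradient φ w) (u - w)) := by
  have hL0 : 0 ≤ L := by linarith
  rcases hL0.eq_or_lt with rfl | hLpos
  · have hρ0 : ρ = 0 := le_antisymm hρ (by simpa using hLρ)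
    have he : ‖gradient φ w - gradient φ u‖ = 0 :=
      le_antisymm (by simpa using hL.2 w u) (norm_nonneg _)
    simp [he, hρ0]
  have hρL : ρ < L := hρ.trans_lt hLpos
  have h1 := bregman_interpolation hL hσ hρσ hρL u w
  have h2 := bregman_interpolation hL hσ hρσ hρL w u
  rw [← neg_sub (gradient φ w) (gradient φ u), ← neg_sub w u, inner_neg_neg, norm_neg, norm_neg]
    at h2
  rw [← neg_sub w u] at h1 ⊢
  rw [inner_neg_right] at h1 ⊢
  rw [inner_sub_left] at h1 h2
  have hpos : 0 < L - ρ := sub_pos.2 hρL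
  -- The two Bregman distances sum to ⟪e, d⟫ (gradient and point increments), so weights `L` and
  -- `-ρ` on the two orderings cancel the inner products.
  refine le_of_mul_le_mul_left ?_ hpos
  nlinarith [mul_le_mul_of_nonneg_left h1 hLpos.le,
    mul_le_mul_of_nonneg_left h2 (neg_nonneg.2 hρ)]

end Smooth

/-! ### Scalar inequalities for the stepsize, the relaxation and the decrease constant. -/

section Parameters

theorem negPart_nonneg (r : ℝ) : 0 ≤ negPart r := le_max_left _ _

theorem neg_le_negPart (r : ℝ) : -r ≤ negPart r := le_max_right _ _

theorem negPart_div {r s : ℝ} (hs : 0 ≤ s) : negPart (r / s) = negPart r / s := by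
  rw [negPart, negPart, ← max_div_div_right hs, zero_div, neg_div]

theorem Admissible.relaxation_pos {L σ γ lam : ℝ} (h : Admissible L σ γ lam) : 0 < lam := by
  rcases h.2 with h | h <;> linarith [h.1, h.2.1]

/-- In the overrelaxed regime, the stepsize lies between the roots of a quadratic polynomial. -/
theorem overrelaxed_quadratic_neg {L σ γ lam : ℝ} (hσ : 0 < σ) (hσL : σ ≤ L)
    (h1 : (σ / L * lam - delta L σ lam) / (4 * σ) < γ)
    (h2 : γ < (σ / L * lam + delta L σ lam) / (4 * σ)) :
    2 * σ * L * γ ^ 2 - σ * lam * γ + lam - 2 < 0 := by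
  have hL : 0 < L := hσ.trans_le hσL
  obtain ⟨q, rfl⟩ : ∃ q, σ = q * L := ⟨σ / L, by field_simp⟩
  have hq : 0 < q := pos_of_mul_pos_left hσ hL.le
  rw [div_lt_iff₀ (by positivity)] at h1
  rw [lt_div_iff₀ (by positivity)] at h2
  rw [mul_div_cancel_right₀ _ hL.ne'] at h1 h2
  rw [delta, mul_div_cancel_right₀ _ hL.ne'] at h1 h2
  set R := (q * lam) ^ 2 - 8 * q * (lam - 2) with hR
  have h3 : 0 < √R := by linarith
  -- Completing the square: 8q times the target polynomial is (4σγ - qλ)² minus the discriminant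
  -- `R`.
  have h4 := sq_lt_sq' (a := γ * (4 * (q * L)) - q * lam) (b := √R) (by linarith) (by linarith)
  rw [Real.sq_sqrt (Real.sqrt_pos.1 h3).le, hR] at h4
  refine neg_of_mul_neg_right (a := 8 * q) ?_ (by positivity)
  nlinarith

/-- In the overrelaxed regime, t = γL ≥ 1 would make the quadratic σγ(2t - λ) + λ - 2 nonnegative:
clear if λ ≤ 2t; otherwise σ ≤ L bounds it below by (t - 1)(2t + 2 - λ), and λ < 4. -/
theorem Admissible.stepsize_mul_lt_one {L σ γ lam : ℝ} (hσL : |σ| ≤ L)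
    (h : Admissible L σ γ lam) : γ * L < 1 := by
  obtain ⟨hγ, h | ⟨hσ, hlam, hlam', h1, h2⟩⟩ := h
  · exact h.2.2.2
  have hσL' : σ ≤ L := (le_abs_self σ).trans hσL
  have hL : 0 < L := hσ.trans_le hσL'
  have h3 := overrelaxed_quadratic_neg hσ hσL' h1 h2
  have h4 : lam < 4 :=
    hlam'.trans_le (div_le_self (by norm_num) (le_add_of_nonneg_right (Real.sqrt_nonneg _)))
  by_contra! h5
  have h6 : 0 ≤ (γ * L - 1) * (2 * (γ * L) + 2 - lam) :=
    mul_nonneg (by linarith) (by linarith)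
  rcases le_total lam (2 * (γ * L)) with h7 | h7
  · nlinarith [mul_nonneg (mul_pos hσ hγ).le (sub_nonneg.2 h7)]
  · nlinarith [mul_nonneg (mul_nonneg (sub_nonneg.2 hσL') hγ.le) (sub_nonneg.2 h7)]

theorem Admissible.decreaseConst_pos {L σ γ lam : ℝ} (hσL : |σ| ≤ L)
    (h : Admissible L σ γ lam) : 0 < decreaseConst L σ γ lam := by
  have hγL := h.stepsize_mul_lt_one hσL
  have hlam := h.relaxation_pos
  have hγ := h.1
  have hL : 0 ≤ L := (abs_nonneg σ).trans hσL
  unfold decreaseConst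
  rcases h.2 with ⟨-, hlam2, hN, -⟩ | ⟨hσ, hlam2, -, h1, h2⟩
  · rw [if_pos hlam2]
    split_ifs with hp
    · have hq0 := negPart_nonneg (σ / L)
      have hq1 : negPart (σ / L) ≤ 1 - lam / 2 := max_le (by linarith) (by linarith)
      set q := negPart (σ / L)
      rw [sub_pos, mul_max_of_nonneg _ _ hL]
      refine max_lt ?_ ?_
      · rw [mul_div_assoc', div_lt_div_iff₀ (by linarith) (by positivity)]
        have h3 : (2 - lam) * lam ≤ (2 - lam) * (2 * (1 - q)) :=
          mul_le_mul_of_nonneg_left (by linarith) (by linarith)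
        refine lt_of_lt_of_le ?_ h3
        rcases hq0.eq_or_lt with hq | hq
        · rw [← hq]
          nlinarith [mul_pos hlam (sub_pos.2 hlam2)]
        · nlinarith [mul_pos (mul_pos hlam hq) (sub_pos.2 hγL),
            mul_le_mul_of_nonneg_left hq1 hlam.le]
      · rw [lt_div_iff₀ (by positivity)]
        have : L * (γ * L / lam - 1 / 2) * (2 * lam * γ) =
          2 * (γ * L) ^ 2 - lam * (γ * L) := by field_simp
        have h0 : 0 ≤ γ * L := by positivity
        nlinarith [mul_pos (sub_pos.2 hγL) (show 0 < 2 + 2 * (γ * L) - lam by linarith)]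
    · rw [sub_pos, div_lt_div_iff₀ hlam (by positivity)]
      nlinarith [mul_lt_mul_of_pos_left hN hlam]
  · rw [if_neg (not_lt.2 hlam2)]
    have h3 := overrelaxed_quadratic_neg hσ ((le_abs_self σ).trans hσL) h1 h2
    -- Here `c` is a negative multiple of the quadratic, so the stepsize interval is exactly where
    -- it is positive.
    have : (2 - lam) / (2 * lam * γ) + σ * (1 / 2 - γ * L / lam) =
      -(2 * σ * L * γ ^ 2 - σ * lam * γ + lam - 2) / (2 * lam * γ) := by field_simp; ring
    rw [this]
    exact div_pos (neg_pos.2 h3) (by positivity)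

/-- The scalar inequality behind sufficient decrease: `D` is the Bregman distance of two points,
`a` and `E` are the squared distances of the points and of the gradients there. -/
theorem Admissible.decreaseConst_mul_le {L σ γ lam D a E : ℝ} (hσL : |σ| ≤ L)
    (h : Admissible L σ γ lam) (ha : 0 ≤ a) (hE : 0 ≤ E) (hEa : E ≤ L ^ 2 * a)
    (hD : σ / 2 * a ≤ D) (hDE : E - negPart σ * L * a ≤ 2 * (L - negPart σ) * D) :
    decreaseConst L σ γ lam * a ≤ D + (2 - lam) / (2 * lam * γ) * a - γ / lam * E := by
  have hγL := h.stepsize_mul_lt_one hσL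
  have hlam := h.relaxation_pos
  have hγ := h.1
  have hL : 0 ≤ L := (abs_nonneg σ).trans hσL
  unfold decreaseConst
  rcases h.2 with ⟨-, hlam2, hN, -⟩ | ⟨hσ, hlam2, -, h1, h2⟩
  · rw [if_pos hlam2]
    rcases hL.eq_or_lt with rfl | hLpos
    · obtain rfl : σ = 0 := abs_nonpos_iff.1 hσL
      obtain rfl : E = 0 := le_antisymm (by simpa using hEa) hE
      rw [if_pos (by simp; linarith)]
      simp at hD ⊢
      exact hD
    split_ifs with hp
    · have hq0 := negPart_nonneg (σ / L)
      have hq1 : negPart (σ / L) ≤ 1 - lam / 2 := max_le (by linarith) (by linarith)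
      have hqN : negPart σ = negPart (σ / L) * L := by rw [negPart_div hL]; field_simp
      rw [hqN] at hDE
      set q := negPart (σ / L)
      set κ := L * max (q / (2 * (1 - q))) (γ * L / lam - 1 / 2) with hκ
      have hK : 0 < 2 * (1 - q) := by linarith
      have hκ1 : q * L ≤ 2 * (1 - q) * κ := by
        have := mul_le_mul_of_nonneg_left
          (le_max_left (q / (2 * (1 - q))) (γ * L / lam - 1 / 2)) hL
        calc q * L = 2 * (1 - q) * (L * (q / (2 * (1 - q)))) := by
              rw [mul_left_comm, mul_div_cancel₀ _ hK.ne', mul_comm]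
          _ ≤ _ := mul_le_mul_of_nonneg_left this hK.le
      have hκ2 : γ / lam * L ^ 2 - L / 2 ≤ κ := by
        have := mul_le_mul_of_nonneg_left
          (le_max_right (q / (2 * (1 - q))) (γ * L / lam - 1 / 2)) hL
        refine le_trans (le_of_eq ?_) this
        ring
      clear_value κ
      set α := γ / lam
      suffices 0 ≤ 2 * (1 - q) * L * (D - α * E + κ * a) by
        have := nonneg_of_mul_nonneg_right this (by positivity)
        linarith
      -- After `hDE` eliminates `D`, the sign of the coefficient of `E` decides whether to use E ≥ 0
      -- or E ≤ L²a; the two cases need the two entries of the max in `κ`.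
      rcases le_total (2 * (1 - q) * L * α) 1 with h1 | h1
      · nlinarith [mul_nonneg (sub_nonneg.2 h1) hE,
          mul_nonneg (mul_nonneg (sub_nonneg.2 hκ1) hL) ha]
      · nlinarith [mul_nonneg (sub_nonneg.2 h1) (sub_nonneg.2 hEa),
          mul_nonneg (mul_nonneg (mul_nonneg (sub_nonneg.2 hκ2) hK.le) hL) ha]
    · have hσL1 : σ < (lam / 2 - 1) * L := (div_lt_iff₀ hLpos).1 (not_le.1 hp)
      have hσ : σ < 0 := hσL1.trans (mul_neg_of_neg_of_pos (by linarith) hLpos)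
      have hN0 : negPart σ = -σ := max_eq_right (by linarith)
      rw [hN0] at hN hDE ⊢
      suffices 0 ≤ lam * D - γ * E - σ * a by
        have h0 : 0 ≤ (lam * D - γ * E - σ * a) / lam := by positivity
        have h1 : (lam * D - γ * E - σ * a) / lam = D - γ / lam * E - σ / lam * a := by
          field_simp
        rw [h1] at h0
        rw [neg_div]
        linarith
      -- Centering at E = σ²a, D = σa/2 turns `hDE` into E - σ²a ≤ 2(L + σ)(D - σa/2), where 2(L +
      -- σ) < λL and γL < 1.
      have h1 : γ * (E - σ ^ 2 * a) ≤ lam * (D - σ / 2 * a) := by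
        rcases le_total E (σ ^ 2 * a) with h2 | h2
        · exact (mul_nonpos_of_nonneg_of_nonpos hγ.le (by linarith)).trans
            (mul_nonneg hlam.le (by linarith))
        · refine le_of_mul_le_mul_left ?_ hLpos
          nlinarith [mul_nonneg (sub_nonneg.2 hγL.le) (sub_nonneg.2 h2),
            mul_nonneg (sub_nonneg.2 hσL1.le) (sub_nonneg.2 hD)]
      nlinarith [mul_nonneg (mul_nonneg (neg_nonneg.2 hσ.le) ha) (sub_nonneg.2 hN.le)]
  · rw [if_neg (not_lt.2 hlam2)]
    have hN0 : negPart σ = 0 := max_eq_left (by linarith)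
    rw [hN0] at hDE
    have hα : 0 ≤ γ / lam := by positivity
    -- Cocoercivity absorbs `E` into 2(γL/λ)D; the remaining nonnegative fraction of `D` is bounded
    -- by strong convexity.
    have hαL : γ * L / lam ≤ 1 / 2 := by
      rw [div_le_div_iff₀ hlam two_pos]; linarith
    rw [mul_div_right_comm] at hαL ⊢
    nlinarith [mul_le_mul_of_nonneg_left hDE hα, mul_le_mul_of_nonneg_left hD (sub_nonneg.2 hαL)]

end Parameters

/-! ### Gradients of composites, limiting subgradients and image functions. -/

section Variational

variable {E F : Type*} [NormedAddCommGroup E] [InnerProductSpace ℝ E] [CompleteSpace E]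
  [NormedAddCommGroup F] [InnerProductSpace ℝ F] [CompleteSpace F]

theorem hasGradientAt_comp_clm {φ : F → ℝ} {v : F} (C : E →L[ℝ] F) (w : E)
    (h : HasGradientAt φ v (C w)) :
    HasGradientAt (fun w => φ (C w)) (ContinuousLinearMap.adjoint C v) w := by
  rw [hasGradientAt_iff_hasFDerivAt] at h ⊢
  have h1 : toDual ℝ E (ContinuousLinearMap.adjoint C v) = (toDual ℝ F v).comp C := by
    ext d
    simp [ContinuousLinearMap.adjoint_inner_left]
  rw [h1]
  exact h.comp w C.hasFDerivAt

theorem hasGradientAt_penalty (C : E →L[ℝ] F) (a y : F) (β : ℝ) (w : E) :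
    HasGradientAt (fun w => inner ℝ y (C w - a) + β / 2 * ‖C w - a‖ ^ 2)
      (ContinuousLinearMap.adjoint C (y + β • (C w - a))) w := by
  rw [hasGradientAt_iff_hasFDerivAt]
  have h1 : HasFDerivAt (fun w => C w - a) C w := C.hasFDerivAt.sub_const a
  have h2 := ((innerSL ℝ y).hasFDerivAt.comp w h1).fun_add (h1.norm_sq.const_mul (β / 2))
  have h3 : toDual ℝ E (ContinuousLinearMap.adjoint C (y + β • (C w - a))) =
      (innerSL ℝ y).comp C + (β / 2) • 2 • (innerSL ℝ (C w - a)).comp C := by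
    ext d
    simp only [toDual_apply_apply, ContinuousLinearMap.adjoint_inner_left, inner_add_left,
      real_inner_smul_left, add_apply, smul_apply,
      ContinuousLinearMap.comp_apply, innerSL_apply_apply, smul_eq_mul, nsmul_eq_mul]
    push_cast
    ring
  rw [h3]
  exact h2

theorem eq_zero_of_hasGradientAt_of_isMin {φ : E → ℝ} {v x : E} (h : HasGradientAt φ v x)
    (hmin : ∀ w, φ x ≤ φ w) : v = 0 := by
  have h1 := IsLocalMin.hasFDerivAt_eq_zero (f := φ) (a := x)
    (Filter.Eventually.of_forall hmin) h.hasFDerivAt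
  simpa using h1

/-- A differentiable minorant touching at `x` already gives a regular subgradient, so constant
sequences suffice. -/
theorem mem_limSubdiff_of_minorant {h : E → EReal} {ψ : E → ℝ} {v x : E} {r : ℝ}
    (hr : h x = (r : EReal)) (hψ : HasGradientAt ψ v x)
    (hle : ∀ w, ((r + (ψ w - ψ x) : ℝ) : EReal) ≤ h w) : v ∈ limSubdiff h x := by
  have hreg : v ∈ regSubdiff h x := by
    refine ⟨by simp [hr], by simp [hr], fun ε hε => ?_⟩
    have h1 := (hasGradientAt_iff_isLittleO.1 hψ).def hε
    filter_upwards [h1] with w hw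
    refine le_trans ?_ (hle w)
    rw [hr, ← EReal.coe_add, EReal.coe_le_coe_iff]
    rw [Real.norm_eq_abs] at hw
    linarith [(abs_le.1 hw).1]
  exact ⟨hreg.1, hreg.2.1, fun _ => x, fun _ => v, fun _ => hreg, tendsto_const_nhds,
    tendsto_const_nhds, tendsto_const_nhds⟩

theorem sub_le_of_add_le {r c c' : ℝ} {t : EReal}
    (h : (r : EReal) + (c : EReal) ≤ t + (c' : EReal)) : ((r + c - c' : ℝ) : EReal) ≤ t := by
  induction t with
  | bot => simp [← EReal.coe_add] at h
  | top => exact le_top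
  | coe t => norm_cast at h ⊢; linarith

theorem ne_top_of_mem_argminSet {X : Type*} {h : X → EReal} {q : X → ℝ} {x : X}
    (hh : IsProper h) (hx : x ∈ argminSet (fun w => h w + (q w : EReal))) : h x ≠ ⊤ := by
  intro htop
  obtain ⟨w, hw⟩ := hh.2
  have h1 : h x + (q x : EReal) ≤ h w + (q w : EReal) := hx w
  rw [htop, EReal.top_add_coe, top_le_iff] at h1
  exact EReal.add_ne_top hw (EReal.coe_ne_top _) h1

/-- Minimization in two stages: `q ∘ C` is constant on fibres of `C`, so a minimizer is optimal on
its fibre and its image solves the reduced problem. -/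
theorem argmin_imageFun {X Y : Type*} {h : X → EReal} {C : X → Y} {φ q : Y → ℝ} {x : X}
    (hh : IsProper h) (hφ : ∀ s, imageFun C h s = (φ s : EReal))
    (hx : x ∈ argminSet (fun w => h w + (q (C w) : EReal))) :
    h x = (φ (C x) : EReal) ∧ ∀ s, φ (C x) + q (C x) ≤ φ s + q s := by
  obtain ⟨r, hr⟩ : ∃ r : ℝ, (r : EReal) = h x :=
    ⟨_, EReal.coe_toReal (ne_top_of_mem_argminSet (q := fun w => q (C w)) hh hx) (hh.1 x)⟩
  have key : ∀ s, r + q (C x) - q s ≤ φ s := fun s => by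
    rw [← EReal.coe_le_coe_iff, ← hφ s]
    refine le_iInf₂ fun w hw => ?_
    subst hw
    refine sub_le_of_add_le ?_
    rw [hr]
    exact hx w
  have hle : φ (C x) ≤ r := by
    rw [← EReal.coe_le_coe_iff, ← hφ, hr]
    exact iInf₂_le (f := fun w (_ : C w = C x) => h w) x rfl
  have heq : r = φ (C x) := le_antisymm (by linarith [key (C x)]) hle
  exact ⟨by rw [← hr, heq], fun s => by linarith [key s]⟩

theorem le_of_lowerSemicontinuous_of_tendsto {X : Type*} [TopologicalSpace X] {h : X → EReal}
    (hh : LowerSemicontinuous h) {xs : ℕ → X} {x : X} {t : ℕ → ℝ} {r : ℝ}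
    (hx : Tendsto xs atTop (𝓝 x)) (ht : Tendsto t atTop (𝓝 r))
    (hle : ∀ k, h (xs k) ≤ (t k : EReal)) : h x ≤ (r : EReal) := by
  refine le_of_forall_lt fun c hc => ?_
  obtain ⟨c', hc, hc'⟩ := exists_between hc
  refine hc.trans_le (ge_of_tendsto ((continuous_coe_real_ereal.tendsto r).comp ht) ?_)
  filter_upwards [hx.eventually (hh x c' hc')] with k hk
  exact hk.le.trans (hle k)

end Variational

/-! ### Rates and limits from summable decrements. -/

section Sequences

/-- At least k/2 squares with indices in [k/2, k) dominate the squared running minimum, and that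
block of a convergent series tends to 0. -/
theorem isLittleO_inf'_of_summable_sq {a : ℕ → ℝ} (ha : ∀ k, 0 ≤ a k)
    (hs : Summable fun k => a k ^ 2) :
    (fun k : ℕ => (Finset.range (k + 1)).inf' Finset.nonempty_range_add_one a)
      =o[atTop] (fun k : ℕ => 1 / √(k : ℝ)) := by
  set m : ℕ → ℝ := fun k => (Finset.range (k + 1)).inf' Finset.nonempty_range_add_one a with hm
  have hm0 : ∀ k, 0 ≤ m k := fun k => Finset.le_inf' _ _ fun i _ => ha i
  have hma : ∀ k, ∀ i < k, m k ≤ a i := fun k i hi =>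
    Finset.inf'_le _ (Finset.mem_range.2 (by omega))
  set S : ℕ → ℝ := fun n => ∑ i ∈ Finset.range n, a i ^ 2 with hS
  have hhalf : Tendsto (fun k : ℕ => k / 2) atTop atTop :=
    Nat.tendsto_div_const_atTop two_ne_zero
  have hST := hs.hasSum.tendsto_sum_nat
  have h0 : Tendsto (fun k => 2 * (S k - S (k / 2))) atTop (𝓝 0) := by
    simpa using (hST.sub (hST.comp hhalf)).const_mul 2
  have hle : ∀ k : ℕ, (k : ℝ) * m k ^ 2 ≤ 2 * (S k - S (k / 2)) := fun k => by
    have h1 : S k - S (k / 2) = ∑ i ∈ Finset.Ico (k / 2) k, a i ^ 2 :=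
      (Finset.sum_Ico_eq_sub _ (Nat.div_le_self k 2)).symm
    have h2 : ((k - k / 2 : ℕ) : ℝ) * m k ^ 2 ≤ S k - S (k / 2) := by
      rw [h1, ← nsmul_eq_mul, ← Nat.card_Ico]
      refine Finset.card_nsmul_le_sum _ _ _ fun i hi => ?_
      exact pow_le_pow_left₀ (hm0 k) (hma k i (Finset.mem_Ico.1 hi).2) 2
    have h3 : (k : ℝ) ≤ 2 * ((k - k / 2 : ℕ) : ℝ) := by
      exact_mod_cast (by omega : k ≤ 2 * (k - k / 2))
    nlinarith [mul_le_mul_of_nonneg_right h3 (sq_nonneg (m k))]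
  have h1 : Tendsto (fun k : ℕ => (k : ℝ) * m k ^ 2) atTop (𝓝 0) :=
    squeeze_zero (fun k => by positivity) hle h0
  refine (isLittleO_iff_tendsto' ?_).2 ?_
  -- At k = 0 the comparison function is 1/√0 = 0, hence only eventual nonvanishing.
  · filter_upwards [eventually_gt_atTop 0] with k hk h
    have : (0 : ℝ) < 1 / √(k : ℝ) := by positivity
    exact absurd h this.ne'
  · have h2 := (Real.continuous_sqrt.tendsto 0).comp h1
    rw [Real.sqrt_zero] at h2
    refine h2.congr fun k => ?_
    simp only [Function.comp_apply]
    rw [Real.sqrt_mul (Nat.cast_nonneg k), Real.sqrt_sq (hm0 k), div_div_eq_mul_div, div_one,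
      mul_comm]

/-- A sequence that is bounded below and decreases sufficiently at every step converges, and the
decrements are summable. -/
theorem tendsto_and_summable_of_decrease {Λ e : ℕ → ℝ} {C μ : ℝ} (hC : 0 < C)
    (he : ∀ k, 0 ≤ e k) (hΛ : ∀ k, Λ (k + 1) ≤ Λ k - C * e k) (hμ : ∀ k, μ ≤ Λ k) :
    (∃ l, Tendsto Λ atTop (𝓝 l)) ∧ Summable e := by
  have hanti : Antitone Λ := antitone_nat_of_succ_le fun k =>
    (hΛ k).trans (sub_le_self _ (mul_nonneg hC.le (he k)))
  refine ⟨⟨_, tendsto_atTop_ciInf hanti ⟨μ, by rintro _ ⟨k, rfl⟩; exact hμ k⟩⟩, ?_⟩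
  refine summable_of_sum_range_le (c := (Λ 0 - μ) / C) he fun n => ?_
  rw [le_div_iff₀' hC, Finset.mul_sum]
  have h1 : ∀ n, ∑ k ∈ Finset.range n, C * e k ≤ Λ 0 - Λ n := fun n => by
    induction n with
    | zero => simp
    | succ n ih => rw [Finset.sum_range_succ]; linarith [hΛ n]
  linarith [h1 n, hμ n]

end Sequences

/-! ### Decrease and lower bound of the Lagrangian in reduced variables. -/

section Decrease

variable {F : Type*} [NormedAddCommGroup F] [InnerProductSpace ℝ F] [CompleteSpace F]

/-- Sufficient decrease of the augmented Lagrangian, in terms of the image function `φ`. -/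
theorem Admissible.sufficient_decrease {L σ γ lam β G G' : ℝ} {φ : F → ℝ} {u u' v v' y y' : F}
    (hβ : β = 1 / γ) (hσL : |σ| ≤ L) (h : Admissible L σ γ lam) (hL : IsSmoothWith L φ)
    (hσ : IsHypoconvex σ φ) (hy : y = -gradient φ u) (hy' : y' = -gradient φ u')
    (hyy' : y' = y - (β * (1 - lam)) • (u - v) + β • (u' - v))
    (hmin : G' + (inner ℝ y' (u' - v') + β / 2 * ‖u' - v'‖ ^ 2) ≤
      G + (inner ℝ y' (u' - v) + β / 2 * ‖u' - v‖ ^ 2)) :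
    φ u' + G' + (inner ℝ y' (u' - v') + β / 2 * ‖u' - v'‖ ^ 2) ≤
      φ u + G + (inner ℝ y (u - v) + β / 2 * ‖u - v‖ ^ 2) -
        decreaseConst L σ γ lam * lam ^ 2 / (1 + γ * L) ^ 2 * ‖u - v‖ ^ 2 := by
  have hγ := h.1
  have hlam := h.relaxation_pos
  have hc := h.decreaseConst_pos hσL
  have hL0 : 0 ≤ L := (abs_nonneg σ).trans hσL
  set c := decreaseConst L σ γ lam with hcdef
  set r := u - v with hr
  set d := u' - u with hd
  set e := gradient φ u' - gradient φ u with he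
  have huv : u' - v = r + d := by rw [hr, hd]; abel
  have hyd : y' = y - e := by rw [hy, hy', he]; abel
  rw [huv] at hmin hyy'
  have hγβ : γ * β = 1 := by rw [hβ, mul_one_div_cancel hγ.ne']
  -- Equating y' - y = -e with the multiplier update expresses the residual through the increments
  -- of `u` alone.
  have hrel : lam • r = -(d + γ • e) := by
    have h1 : e = (β * (1 - lam)) • r - β • (r + d) := by
      rw [hyd, sub_add, sub_right_inj] at hyy'
      exact hyy'
    clear_value r d e
    rw [h1, smul_sub, smul_smul, smul_smul, ← mul_assoc, hγβ]
    module
  have hnr : lam * ‖r‖ ≤ (1 + γ * L) * ‖d‖ := by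
    calc lam * ‖r‖ = ‖d + γ • e‖ := by
          rw [← norm_neg (d + γ • e), ← hrel, norm_smul, Real.norm_of_nonneg hlam.le]
      _ ≤ ‖d‖ + γ * ‖e‖ := by
          refine (norm_add_le _ _).trans_eq ?_
          rw [norm_smul, Real.norm_of_nonneg hγ.le]
      _ ≤ ‖d‖ + γ * (L * ‖d‖) := by gcongr; exact hL.2 u' u
      _ = _ := by ring
  have hcr : c * lam ^ 2 / (1 + γ * L) ^ 2 * ‖r‖ ^ 2 ≤ c * ‖d‖ ^ 2 := by
    have hpos : 0 < 1 + γ * L := by positivity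
    have h1 : (lam * ‖r‖) ^ 2 ≤ ((1 + γ * L) * ‖d‖) ^ 2 :=
      pow_le_pow_left₀ (by positivity) hnr 2
    rw [div_mul_eq_mul_div, div_le_iff₀ (by positivity)]
    nlinarith [mul_le_mul_of_nonneg_left h1 hc.le]
  have hN : -L ≤ -negPart σ :=
    neg_le_neg (max_le hL0 ((neg_le_abs σ).trans hσL))
  have hD1 := bregman_cocoercive (ρ := -negPart σ) hL hσ hN (neg_nonpos.2 (negPart_nonneg σ))
    (by linarith [neg_le_negPart σ]) u u'
  have hD2 := hσ.quadratic_le (hasGradientAt_of_isSmoothWith hL u') u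
  have hud : u - u' = -d := by rw [hd]; abel
  rw [hud] at hD1 hD2
  rw [norm_neg] at hD2
  have hEa : ‖e‖ ^ 2 ≤ L ^ 2 * ‖d‖ ^ 2 := by
    rw [← mul_pow]; exact pow_le_pow_left₀ (norm_nonneg _) (hL.2 u' u) 2
  have hmain := h.decreaseConst_mul_le (D := φ u - φ u' - inner ℝ (gradient φ u') (-d))
    hσL (sq_nonneg ‖d‖) (sq_nonneg ‖e‖) hEa (by linarith) (by linarith)
  have hyg : gradient φ u' = -y' := by rw [hy', neg_neg]
  rw [hyg, inner_neg_neg] at hmain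
  have hr' : r = (-lam⁻¹) • (d + γ • e) := by
    rw [neg_smul, ← smul_neg, ← hrel, inv_smul_smul₀ hlam.ne']
  have e1 : inner ℝ e r = -lam⁻¹ * (inner ℝ e d + γ * ‖e‖ ^ 2) := by
    rw [hr', real_inner_smul_right, inner_add_right, real_inner_smul_right,
      real_inner_self_eq_norm_sq]
  have e2 : inner ℝ r d = -lam⁻¹ * (‖d‖ ^ 2 + γ * inner ℝ e d) := by
    rw [hr', real_inner_smul_left, inner_add_left, real_inner_smul_left,
      real_inner_self_eq_norm_sq]
  have e3 : ‖r + d‖ ^ 2 = ‖r‖ ^ 2 + 2 * inner ℝ r d + ‖d‖ ^ 2 := norm_add_sq_real r d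
  have e4 : inner ℝ y r = inner ℝ y' r + inner ℝ e r := by
    rw [hyd, ← inner_add_left, sub_add_cancel]
  -- Substituting for `r` cancels the cross terms ⟪e, d⟫ and leaves the scalar expression of
  -- `hmain`.
  have e5 : inner ℝ e r - β * inner ℝ r d - β / 2 * ‖d‖ ^ 2 =
      (2 - lam) / (2 * lam * γ) * ‖d‖ ^ 2 - γ / lam * ‖e‖ ^ 2 := by
    rw [e1, e2, hβ]
    field_simp
    ring
  rw [e3, inner_add_right] at hmin
  rw [e4]
  linarith

/-- The augmented Lagrangian majorizes the cost at a feasible point. -/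
theorem IsSmoothWith.add_le_augmented {L β G : ℝ} {φ : F → ℝ} {u v y : F}
    (hL : IsSmoothWith L φ) (hy : y = -gradient φ u) :
    φ v + G + (β - L) / 2 * ‖u - v‖ ^ 2 ≤
      φ u + G + (inner ℝ y (u - v) + β / 2 * ‖u - v‖ ^ 2) := by
  have h := hL.le_quadratic u v
  rw [hy, inner_neg_left, ← inner_neg_right, neg_sub]
  rw [norm_sub_rev v u] at h
  linarith

end Decrease

section Smooth

variable {E : Type*} [NormedAddCommGroup E] [InnerProductSpace ℝ E] [CompleteSpace E]

theorem IsSmoothWith.continuous_gradient {L : ℝ} {φ : E → ℝ} (h : IsSmoothWith L φ) :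
    Continuous (gradient φ) := by
  refine (LipschitzWith.of_dist_le_mul (K := L.toNNReal) fun u w => ?_).continuous
  rw [dist_eq_norm, dist_eq_norm]
  exact (h.2 u w).trans (mul_le_mul_of_nonneg_right (Real.le_coe_toNNReal L) (norm_nonneg _))

end Smooth

theorem exists_lt_of_imageFun {X Y : Type*} {h : X → EReal} {C : X → Y} {s : Y} {t : EReal}
    (hlt : imageFun C h s < t) : ∃ x, C x = s ∧ h x < t := by
  obtain ⟨x, hx⟩ := iInf_lt_iff.1 hlt
  obtain ⟨hxs, hx⟩ := iInf_lt_iff.1 hx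
  exact ⟨x, hxs, hx⟩

/-! ### From ADMM steps to conditions on the image function. -/

section Problem

variable {m n p : ℕ}
  {f : EuclideanSpace ℝ (Fin m) → EReal} {g : EuclideanSpace ℝ (Fin n) → EReal}
  {A : EuclideanSpace ℝ (Fin m) →L[ℝ] EuclideanSpace ℝ (Fin p)}
  {B : EuclideanSpace ℝ (Fin n) →L[ℝ] EuclideanSpace ℝ (Fin p)}
  {b : EuclideanSpace ℝ (Fin p)} {β γ lam L σ : ℝ}
  {φ : EuclideanSpace ℝ (Fin p) → ℝ}

theorem residual_eq_sub (x : EuclideanSpace ℝ (Fin m)) (z : EuclideanSpace ℝ (Fin n)) :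
    residual A B b x z = A x - (b - B z) := by
  rw [residual]; abel

theorem residual_eq_sub' (x : EuclideanSpace ℝ (Fin m)) (z : EuclideanSpace ℝ (Fin n)) :
    residual A B b x z = B z - (b - A x) := by
  rw [residual]; abel

theorem totalCost_of_feasible {x : EuclideanSpace ℝ (Fin m)} {z : EuclideanSpace ℝ (Fin n)}
    (h : A x + B z = b) : totalCost f g A B b (x, z) = f x + g z := if_pos h

/-- The optimal value is finite; it bounds the reduced cost from below. -/
theorem Assumptions.exists_lower_bound (hass : Assumptions f g A B b β L σ)
    (hφ : ∀ s, imageFun A f s = (φ s : EReal)) :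
    ∃ μ : ℝ, ∀ (z : EuclideanSpace ℝ (Fin n)) (G : ℝ), g z = (G : EReal) →
      μ ≤ φ (b - B z) + G := by
  obtain ⟨⟨x₀, z₀⟩, h₀⟩ := hass.exists_solution
  -- Since φ is real valued, every z₁ in the domain of `g` extends to a feasible pair of finite
  -- cost.
  have hlt : totalCost f g A B b (x₀, z₀) < ⊤ := by
    obtain ⟨z₁, hz₁⟩ := hass.g_proper.2
    obtain ⟨x₁, hx₁, hfx₁⟩ := exists_lt_of_imageFun (C := A) (h := f) (s := b - B z₁) (t := ⊤)
      (by rw [hφ]; exact EReal.coe_lt_top _)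
    refine (h₀ (x₁, z₁)).trans_lt ?_
    rw [totalCost_of_feasible (by rw [hx₁, sub_add_cancel])]
    exact EReal.add_lt_top hfx₁.ne hz₁
  have hfeas : A x₀ + B z₀ = b := by
    by_contra hne
    rw [totalCost, if_neg hne] at hlt
    exact lt_irrefl _ hlt
  have hbot : totalCost f g A B b (x₀, z₀) ≠ ⊥ := by
    rw [totalCost_of_feasible hfeas, Ne, EReal.add_eq_bot_iff, not_or]
    exact ⟨hass.f_proper.1 x₀, hass.g_proper.1 z₀⟩
  refine ⟨(totalCost f g A B b (x₀, z₀)).toReal, fun z G hG => ?_⟩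
  suffices (((totalCost f g A B b (x₀, z₀)).toReal + 0 - G : ℝ) : EReal) ≤ (φ (b - B z) : EReal) by
    linarith [EReal.coe_le_coe_iff.1 this]
  rw [← hφ]
  refine le_iInf₂ fun w hw => sub_le_of_add_le ?_
  rw [EReal.coe_toReal hlt.ne hbot, EReal.coe_zero, add_zero, ← hG,
    ← totalCost_of_feasible (A := A) (B := B) (b := b) (by rw [hw, sub_add_cancel])]
  exact h₀ (w, z)

/-- The conditions on ADMM iterates in terms of the image function `φ` of `f` and of the finite
values `G k` of `g`. -/
structure IsTrace (f : EuclideanSpace ℝ (Fin m) → EReal) (g : EuclideanSpace ℝ (Fin n) → EReal)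
    (A : EuclideanSpace ℝ (Fin m) →L[ℝ] EuclideanSpace ℝ (Fin p))
    (B : EuclideanSpace ℝ (Fin n) →L[ℝ] EuclideanSpace ℝ (Fin p))
    (b : EuclideanSpace ℝ (Fin p)) (β lam : ℝ) (φ : EuclideanSpace ℝ (Fin p) → ℝ) (G : ℕ → ℝ)
    (x : ℕ → EuclideanSpace ℝ (Fin m)) (y : ℕ → EuclideanSpace ℝ (Fin p))
    (z : ℕ → EuclideanSpace ℝ (Fin n)) : Prop where
  f_eq : ∀ k, f (x k) = (φ (A (x k)) : EReal)
  g_eq : ∀ k, g (z k) = (G k : EReal)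
  y_eq : ∀ k, y k = -gradient φ (A (x k))
  z_mem : ∀ k, z k ∈ argminZ g A B b β (x k) (y k)
  update : ∀ k, y (k + 1) = y k - (β * (1 - lam)) • residual A B b (x k) (z k) +
    β • residual A B b (x (k + 1)) (z k)

/-- The updated multiplier is the gradient of the reduced coupling at Ax', so stationarity reads
∇φ(Ax') + y' = 0. -/
theorem ADMMStep.eq_and_gradient {x x' : EuclideanSpace ℝ (Fin m)}
    {y y' : EuclideanSpace ℝ (Fin p)} {z z' : EuclideanSpace ℝ (Fin n)}
    (hf : IsProper f) (hφ : ∀ s, imageFun A f s = (φ s : EReal)) (hL : IsSmoothWith L φ)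
    (h : ADMMStep f g A B b β lam x y z x' y' z') :
    f x' = (φ (A x') : EReal) ∧ y' = -gradient φ (A x') := by
  obtain ⟨yh, -, hx, hy, -⟩ := h
  let q : EuclideanSpace ℝ (Fin p) → ℝ := fun s =>
    inner ℝ yh (s - (b - B z)) + β / 2 * ‖s - (b - B z)‖ ^ 2
  have hx' : x' ∈ argminSet (fun w => f w + (q (A w) : EReal)) := by
    simpa only [argminX, coupling, residual_eq_sub] using hx
  obtain ⟨h1, h2⟩ := argmin_imageFun hf hφ hx'
  refine ⟨h1, ?_⟩
  have h3 := hasGradientAt_penalty (ContinuousLinearMap.id ℝ (EuclideanSpace ℝ (Fin p)))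
    (b - B z) yh β (A x')
  have h4 : HasGradientAt (fun s => φ s + q s) (gradient φ (A x') + y') (A x') := by
    rw [hasGradientAt_iff_hasFDerivAt] at h3 ⊢
    have h5 := (hasGradientAt_of_isSmoothWith hL (A x')).hasFDerivAt.fun_add h3
    rw [← map_add] at h5
    rw [hy, residual_eq_sub]
    simpa [ContinuousLinearMap.adjoint_id] using h5
  exact (neg_eq_of_add_eq_zero_right (eq_zero_of_hasGradientAt_of_isMin h4 h2)).symm

theorem ADMMStep.g_ne_top {x x' : EuclideanSpace ℝ (Fin m)}
    {y y' : EuclideanSpace ℝ (Fin p)} {z z' : EuclideanSpace ℝ (Fin n)} (hg : IsProper g)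
    (h : ADMMStep f g A B b β lam x y z x' y' z') : g z' ≠ ⊤ := by
  obtain ⟨yh, -, -, -, hz⟩ := h
  exact ne_top_of_mem_argminSet (q := fun w => coupling A B b β x' w y') hg hz

theorem isTrace_of_steps {x : ℕ → EuclideanSpace ℝ (Fin m)} {y : ℕ → EuclideanSpace ℝ (Fin p)}
    {z : ℕ → EuclideanSpace ℝ (Fin n)} {xi : EuclideanSpace ℝ (Fin m)}
    {yi : EuclideanSpace ℝ (Fin p)} {zi : EuclideanSpace ℝ (Fin n)}
    (hf : IsProper f) (hg : IsProper g) (hφ : ∀ s, imageFun A f s = (φ s : EReal))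
    (hL : IsSmoothWith L φ)
    (hinit : ADMMStep f g A B b β lam xi yi zi (x 0) (y 0) (z 0))
    (hstep : ∀ k, ADMMStep f g A B b β lam (x k) (y k) (z k) (x (k + 1)) (y (k + 1)) (z (k + 1))) :
    IsTrace f g A B b β lam φ (fun k => (g (z k)).toReal) x y z := by
  -- Index 0 is also the outcome of a step, so nothing is required of the starting point.
  have hall : ∀ k, ∃ x' y' z', ADMMStep f g A B b β lam x' y' z' (x k) (y k) (z k)
    | 0 => ⟨_, _, _, hinit⟩
    | k + 1 => ⟨_, _, _, hstep k⟩
  constructor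
  · intro k
    obtain ⟨_, _, _, h⟩ := hall k
    exact (h.eq_and_gradient hf hφ hL).1
  · intro k
    obtain ⟨_, _, _, h⟩ := hall k
    exact (EReal.coe_toReal (h.g_ne_top hg) (hg.1 _)).symm
  · intro k
    obtain ⟨_, _, _, h⟩ := hall k
    exact (h.eq_and_gradient hf hφ hL).2
  · intro k
    obtain ⟨_, _, _, _, -, -, -, h⟩ := hall k
    exact h
  · intro k
    obtain ⟨_, rfl, -, h, -⟩ := hstep k
    exact h

/-! ### Convergence and boundedness along the iterates. -/

namespace IsTrace

variable {G : ℕ → ℝ} {x : ℕ → EuclideanSpace ℝ (Fin m)} {y : ℕ → EuclideanSpace ℝ (Fin p)}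
  {z : ℕ → EuclideanSpace ℝ (Fin n)}

/-- The real value of the augmented Lagrangian along the iterates. -/
noncomputable def lagrangian (_ : IsTrace f g A B b β lam φ G x y z) (k : ℕ) : ℝ :=
  φ (A (x k)) + G k + coupling A B b β (x k) (z k) (y k)

theorem augLag_eq (h : IsTrace f g A B b β lam φ G x y z) (k : ℕ) :
    augLag f g A B b β (x k) (z k) (y k) = (h.lagrangian k : EReal) := by
  rw [augLag, h.f_eq, h.g_eq, lagrangian, EReal.coe_add, EReal.coe_add]

theorem lagrangian_succ_le (h : IsTrace f g A B b β lam φ G x y z) (hβ : β = 1 / γ)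
    (hσL : |σ| ≤ L) (hpar : Admissible L σ γ lam) (hL : IsSmoothWith L φ)
    (hσ : IsHypoconvex σ φ) (k : ℕ) :
    h.lagrangian (k + 1) ≤ h.lagrangian k -
      decreaseConst L σ γ lam * lam ^ 2 / (1 + γ * L) ^ 2 *
        ‖residual A B b (x k) (z k)‖ ^ 2 := by
  -- The new z-minimizer is tested against the previous `z k`.
  have hmin := h.z_mem (k + 1) (z k)
  dsimp only at hmin
  rw [h.g_eq, h.g_eq, ← EReal.coe_add, ← EReal.coe_add, EReal.coe_le_coe_iff] at hmin
  have hupd := h.update k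
  simp only [lagrangian, coupling, residual_eq_sub] at hmin hupd ⊢
  exact hpar.sufficient_decrease hβ hσL hL hσ (h.y_eq k) (h.y_eq (k + 1)) hupd hmin

theorem reduced_le_lagrangian (h : IsTrace f g A B b β lam φ G x y z) (hL : IsSmoothWith L φ)
    (hβL : L ≤ β) (k : ℕ) : φ (b - B (z k)) + G k ≤ h.lagrangian k := by
  have h1 := hL.add_le_augmented (β := β) (G := G k) (v := b - B (z k)) (h.y_eq k)
  simp only [lagrangian, coupling, residual_eq_sub]
  have h2 : 0 ≤ (β - L) / 2 * ‖A (x k) - (b - B (z k))‖ ^ 2 :=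
    mul_nonneg (by linarith) (sq_nonneg _)
  linarith

theorem tendsto_coupling {X : Type*} {F : Filter X} {xs : X → EuclideanSpace ℝ (Fin m)}
    {zs : X → EuclideanSpace ℝ (Fin n)} {ys : X → EuclideanSpace ℝ (Fin p)}
    {x' : EuclideanSpace ℝ (Fin m)} {z' : EuclideanSpace ℝ (Fin n)} {y' : EuclideanSpace ℝ (Fin p)}
    (hx : Tendsto xs F (𝓝 x')) (hz : Tendsto zs F (𝓝 z')) (hy : Tendsto ys F (𝓝 y')) :
    Tendsto (fun k => coupling A B b β (xs k) (zs k) (ys k)) F (𝓝 (coupling A B b β x' z' y')) := by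
  have hr : Tendsto (fun k => residual A B b (xs k) (zs k)) F (𝓝 (residual A B b x' z')) :=
    (((A.continuous.tendsto x').comp hx).add ((B.continuous.tendsto z').comp hz)).sub_const b
  exact (hy.inner hr).add ((hr.norm.pow 2).const_mul (β / 2))

theorem adjoint_gradient_mem_limSubdiff {x' : EuclideanSpace ℝ (Fin m)}
    (hφ : ∀ s, imageFun A f s = (φ s : EReal)) (hL : IsSmoothWith L φ)
    (hx : f x' = (φ (A x') : EReal)) :
    ContinuousLinearMap.adjoint A (gradient φ (A x')) ∈ limSubdiff f x' := by
  refine mem_limSubdiff_of_minorant (ψ := fun w => φ (A w)) hx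
    (hasGradientAt_comp_clm A x' (hasGradientAt_of_isSmoothWith hL (A x'))) fun w => ?_
  rw [add_sub_cancel, ← hφ]
  exact iInf₂_le (f := fun u (_ : A u = A w) => f u) w rfl

/-- Minus the coupling, shifted by a constant, minorizes `g`; at a feasible point the penalty
contributes nothing to its gradient. -/
theorem neg_adjoint_mem_limSubdiff {x' : EuclideanSpace ℝ (Fin m)}
    {y' : EuclideanSpace ℝ (Fin p)} {z' : EuclideanSpace ℝ (Fin n)} {r : ℝ}
    (hfeas : residual A B b x' z' = 0) (hr : g z' = (r : EReal))
    (hle : ∀ w, ((r - coupling A B b β x' w y' : ℝ) : EReal) ≤ g w) :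
    -(ContinuousLinearMap.adjoint B y') ∈ limSubdiff g z' := by
  refine mem_limSubdiff_of_minorant (ψ := fun w => -coupling A B b β x' w y') hr ?_ fun w => ?_
  · have h := hasGradientAt_penalty B (b - A x') (-y') (-β) z'
    rw [← residual_eq_sub', hfeas, smul_zero, add_zero, map_neg] at h
    convert h using 2 with w
    rw [coupling, residual_eq_sub', inner_neg_left]
    ring
  · have h0 : coupling A B b β x' z' y' = 0 := by simp [coupling, hfeas]
    rw [h0, neg_zero, sub_zero, ← sub_eq_add_neg]
    exact hle w

theorem cluster_isKKT (h : IsTrace f g A B b β lam φ G x y z) (hf : LowerSemicontinuous f)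
    (hg : LowerSemicontinuous g) (hφ : ∀ s, imageFun A f s = (φ s : EReal))
    (hL : IsSmoothWith L φ)
    (hres : Tendsto (fun k => residual A B b (x k) (z k)) atTop (𝓝 0)) {l : ℝ}
    (hl : Tendsto h.lagrangian atTop (𝓝 l)) {x' : EuclideanSpace ℝ (Fin m)}
    {z' : EuclideanSpace ℝ (Fin n)} {y' : EuclideanSpace ℝ (Fin p)}
    (hcl : MapClusterPt (x', z', y') atTop (fun k => (x k, z k, y k))) :
    -(ContinuousLinearMap.adjoint A y') ∈ limSubdiff f x' ∧
      -(ContinuousLinearMap.adjoint B y') ∈ limSubdiff g z' ∧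
      A x' + B z' = b ∧ f x' + g z' = (l : EReal) := by
  obtain ⟨θ, hθ, hlim⟩ := hcl.tendsto_subseq
  have hθ := hθ.tendsto_atTop
  have hx : Tendsto (fun k => x (θ k)) atTop (𝓝 x') := hlim.fst_nhds
  have hz : Tendsto (fun k => z (θ k)) atTop (𝓝 z') := hlim.snd_nhds.fst_nhds
  have hy : Tendsto (fun k => y (θ k)) atTop (𝓝 y') := hlim.snd_nhds.snd_nhds
  have hfeas : residual A B b x' z' = 0 := by
    refine tendsto_nhds_unique ?_ (hres.comp hθ)
    exact (((A.continuous.tendsto x').comp hx).add ((B.continuous.tendsto z').comp hz)).sub_const b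
  have hAx : Tendsto (fun k => A (x (θ k))) atTop (𝓝 (A x')) := (A.continuous.tendsto x').comp hx
  have hφx : Tendsto (fun k => φ (A (x (θ k)))) atTop (𝓝 (φ (A x'))) :=
    (hL.1.continuous.tendsto (A x')).comp hAx
  have hy' : y' = -gradient φ (A x') := by
    refine tendsto_nhds_unique hy ?_
    simp_rw [h.y_eq]
    exact ((hL.continuous_gradient.tendsto (A x')).comp hAx).neg
  have h0 : coupling A B b β x' z' y' = 0 := by simp [coupling, hfeas]
  -- As `g` is only lsc, the limit of its values is read off from the Lagrangian.
  have hG : Tendsto (fun k => G (θ k)) atTop (𝓝 (l - φ (A x'))) := by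
    have h1 := ((hl.comp hθ).sub hφx).sub
      (tendsto_coupling (A := A) (B := B) (b := b) (β := β) hx hz hy)
    rw [h0, sub_zero] at h1
    refine h1.congr fun k => ?_
    simp only [Function.comp_apply, lagrangian]
    ring
  have hfx : f x' = (φ (A x') : EReal) := by
    refine le_antisymm (le_of_lowerSemicontinuous_of_tendsto hf hx hφx fun k => (h.f_eq _).le) ?_
    rw [← hφ]
    exact iInf₂_le (f := fun u (_ : A u = A x') => f u) x' rfl
  have hmin : ∀ w, ((l - φ (A x') - coupling A B b β x' w y' : ℝ) : EReal) ≤ g w := fun w => by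
    have h1 : Tendsto (fun k => G (θ k) + coupling A B b β (x (θ k)) (z (θ k)) (y (θ k)) -
        coupling A B b β (x (θ k)) w (y (θ k))) atTop
        (𝓝 (l - φ (A x') + 0 - coupling A B b β x' w y')) :=
      (hG.add (h0 ▸ tendsto_coupling hx hz hy)).sub (tendsto_coupling hx tendsto_const_nhds hy)
    rw [add_zero] at h1
    have h2 : ∀ k, ((G (θ k) + coupling A B b β (x (θ k)) (z (θ k)) (y (θ k)) -
        coupling A B b β (x (θ k)) w (y (θ k)) : ℝ) : EReal) ≤ g w := fun k => by
      have h3 := h.z_mem (θ k) w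
      dsimp only at h3
      rw [h.g_eq] at h3
      exact sub_le_of_add_le h3
    exact le_of_tendsto' ((continuous_coe_real_ereal.tendsto _).comp h1) h2
  -- Lower semicontinuity gives one inequality, limiting z-minimality tested at `z'` the other.
  have hgz : g z' = ((l - φ (A x') : ℝ) : EReal) := by
    refine le_antisymm (le_of_lowerSemicontinuous_of_tendsto hg hz hG fun k => (h.g_eq _).le) ?_
    have := hmin z'
    rwa [h0, sub_zero] at this
  refine ⟨?_, neg_adjoint_mem_limSubdiff hfeas hgz hmin, sub_eq_zero.1 hfeas, ?_⟩
  · rw [hy', map_neg, neg_neg]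
    exact adjoint_gradient_mem_limSubdiff hφ hL hfx
  · rw [hfx, hgz, ← EReal.coe_add, add_sub_cancel]

theorem exists_norm_le (h : IsTrace f g A B b β lam φ G x y z)
    (hlev : LevelBounded (totalCost f g A B b)) (hφ : ∀ s, imageFun A f s = (φ s : EReal))
    {α : ℝ} (hα : ∀ k, φ (b - B (z k)) + G k ≤ α) : ∃ R, ∀ k, ‖z k‖ ≤ R := by
  obtain ⟨R, hR⟩ := isBounded_iff_forall_norm_le.1 (hlev (α + 1))
  refine ⟨R, fun k => ?_⟩
  -- The infimum over the fibre need not be attained; the slack 1 accounts for the level `α + 1`.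
  obtain ⟨w, hw, hfw⟩ := exists_lt_of_imageFun (C := A) (h := f) (s := b - B (z k))
    (t := ((φ (b - B (z k)) + 1 : ℝ) : EReal))
    (by rw [hφ, EReal.coe_lt_coe_iff]; exact lt_add_one _)
  refine (norm_snd_le (w, z k)).trans (hR (w, z k) ?_)
  show totalCost f g A B b (w, z k) ≤ _
  rw [totalCost_of_feasible (by rw [hw, sub_add_cancel]), h.g_eq]
  refine (add_le_add_left hfw.le _).trans ?_
  rw [← EReal.coe_add, EReal.coe_le_coe_iff]
  linarith [hα k]

/-- With T a right inverse of A, x - Tr is feasible with z and at bounded distance from x. As ∇F(x)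
= -Aᵀy, the descent lemma bounds its cost by the Lagrangian plus a constant. -/
theorem exists_norm_le_of_smooth (h : IsTrace f g A B b β lam φ G x y z) {Lf α R : ℝ}
    {F : EuclideanSpace ℝ (Fin m) → ℝ} (hβ : 0 ≤ β) (hA : Function.Surjective A)
    (hlev : LevelBounded (totalCost f g A B b)) (hφ : ∀ s, imageFun A f s = (φ s : EReal))
    (hL : IsSmoothWith L φ) (hF : ∀ w, f w = (F w : EReal)) (hLf : IsSmoothWith Lf F)
    (hα : ∀ k, h.lagrangian k ≤ α) (hR : ∀ k, ‖residual A B b (x k) (z k)‖ ≤ R) :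
    ∃ R', ∀ k, ‖x k‖ ≤ R' := by
  obtain ⟨T', hT'⟩ := A.toLinearMap.exists_rightInverse_of_surjective
    (LinearMap.range_eq_top.2 hA)
  let T := LinearMap.toContinuousLinearMap T'
  have hT : ∀ s, A (T s) = s := fun s => LinearMap.congr_fun hT' s
  clear_value T
  have hR0 : 0 ≤ R := (norm_nonneg _).trans (hR 0)
  have hTR : ∀ k, ‖T (residual A B b (x k) (z k))‖ ≤ ‖T‖ * R := fun k =>
    (T.le_opNorm _).trans (mul_le_mul_of_nonneg_left (hR k) (norm_nonneg _))
  obtain ⟨R', hR'⟩ := isBounded_iff_forall_norm_le.1 (hlev (α + |Lf| / 2 * (‖T‖ * R) ^ 2))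
  refine ⟨R' + ‖T‖ * R, fun k => ?_⟩
  set r := residual A B b (x k) (z k) with hr
  have hFx : F (x k) = φ (A (x k)) := by
    rw [← EReal.coe_eq_coe_iff, ← hF, h.f_eq]
  -- F - φ∘A is nonnegative and vanishes at `x k`.
  have hgrad : gradient F (x k) - ContinuousLinearMap.adjoint A (gradient φ (A (x k))) = 0 := by
    refine eq_zero_of_hasGradientAt_of_isMin (φ := fun w => F w - φ (A w)) (x := x k) ?_
      fun w => ?_
    · have h1 := hasGradientAt_comp_clm A (x k) (hasGradientAt_of_isSmoothWith hL (A (x k)))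
      have h2 := (hasGradientAt_of_isSmoothWith hLf (x k)).hasFDerivAt.fun_sub h1.hasFDerivAt
      rw [← map_sub] at h2
      exact h2
    · have h1 : φ (A w) ≤ F w := by
        rw [← EReal.coe_le_coe_iff, ← hφ, ← hF]
        exact iInf₂_le (f := fun u (_ : A u = A w) => f u) w rfl
      rw [hFx]
      linarith
  have hdesc := hLf.le_quadratic (x k) (x k - T r)
  rw [sub_sub_cancel_left, inner_neg_right, sub_eq_zero.1 hgrad,
    ContinuousLinearMap.adjoint_inner_left, hT, ← inner_neg_left, ← h.y_eq, norm_neg, hFx] at hdesc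
  have hq : Lf / 2 * ‖T r‖ ^ 2 ≤ |Lf| / 2 * (‖T‖ * R) ^ 2 := by
    have h1 : ‖T r‖ ^ 2 ≤ (‖T‖ * R) ^ 2 := pow_le_pow_left₀ (norm_nonneg _) (hTR k) 2
    exact mul_le_mul (by linarith [le_abs_self Lf]) h1 (sq_nonneg _) (by positivity)
  have hα' := hα k
  simp only [lagrangian, coupling, ← hr] at hα'
  have hx : ‖x k - T r‖ ≤ R' := by
    refine (norm_fst_le (x k - T r, z k)).trans (hR' (x k - T r, z k) ?_)
    show totalCost f g A B b (x k - T r, z k) ≤ _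
    rw [totalCost_of_feasible (by rw [map_sub, hT, hr, residual]; abel), h.g_eq, hF,
      ← EReal.coe_add, EReal.coe_le_coe_iff]
    have h1 : 0 ≤ β / 2 * ‖r‖ ^ 2 := by positivity
    linarith
  calc ‖x k‖ = ‖(x k - T r) + T r‖ := by rw [sub_add_cancel]
    _ ≤ R' + ‖T‖ * R := (norm_add_le _ _).trans (add_le_add hx (hTR k))

end IsTrace

theorem isBounded_range_triple {X Y Z : Type*} [SeminormedAddCommGroup X]
    [SeminormedAddCommGroup Y] [SeminormedAddCommGroup Z] {x : ℕ → X} {y : ℕ → Y} {z : ℕ → Z}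
    {R₁ R₂ R₃ : ℝ} (hx : ∀ k, ‖x k‖ ≤ R₁) (hy : ∀ k, ‖y k‖ ≤ R₂) (hz : ∀ k, ‖z k‖ ≤ R₃) :
    Bornology.IsBounded (Set.range fun k => (x k, y k, z k)) := by
  refine isBounded_iff_forall_norm_le.2 ⟨max R₁ (max R₂ R₃), ?_⟩
  rintro _ ⟨k, rfl⟩
  exact max_le_max (hx k) (max_le_max (hy k) (hz k))

end Problem

end ADMM

/-! ### Assembly of the convergence theorem. -/

theorem mainTheorem7 {m n p : ℕ}
    (f : EuclideanSpace ℝ (Fin m) → EReal) (g : EuclideanSpace ℝ (Fin n) → EReal)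
    (A : EuclideanSpace ℝ (Fin m) →L[ℝ] EuclideanSpace ℝ (Fin p))
    (B : EuclideanSpace ℝ (Fin n) →L[ℝ] EuclideanSpace ℝ (Fin p))
    (b : EuclideanSpace ℝ (Fin p)) (β γ lam L σ : ℝ)
    (hβ : β = 1 / γ)
    (hass : ADMM.Assumptions f g A B b β L σ)
    (hpar : ADMM.Admissible L σ γ lam)
    (xinit : EuclideanSpace ℝ (Fin m)) (yinit : EuclideanSpace ℝ (Fin p))
    (zinit : EuclideanSpace ℝ (Fin n))
    (x : ℕ → EuclideanSpace ℝ (Fin m)) (y : ℕ → EuclideanSpace ℝ (Fin p))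
    (z : ℕ → EuclideanSpace ℝ (Fin n))
    (hinit : ADMM.ADMMStep f g A B b β lam xinit yinit zinit (x 0) (y 0) (z 0))
    (hstep : ∀ k, ADMM.ADMMStep f g A B b β lam (x k) (y k) (z k)
      (x (k + 1)) (y (k + 1)) (z (k + 1))) :
    -- sufficient decrease with a strictly positive constant, and vanishing residual
    (0 < ADMM.decreaseConst L σ γ lam ∧
      (∀ k, f (x k) ≠ ⊤ ∧ g (z k) ≠ ⊤) ∧
      (∀ k, ADMM.augLag f g A B b β (x (k + 1)) (z (k + 1)) (y (k + 1)) ≤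
        ADMM.augLag f g A B b β (x k) (z k) (y k) -
          ((ADMM.decreaseConst L σ γ lam * lam ^ 2 / (1 + γ * L) ^ 2 *
            ‖A (x k) + B (z k) - b‖ ^ 2 : ℝ) : EReal)) ∧
      Tendsto (fun k => A (x k) + B (z k) - b) atTop (𝓝 0) ∧
      (fun k : ℕ => (Finset.range (k + 1)).inf' Finset.nonempty_range_add_one
        (fun i => ‖A (x i) + B (z i) - b‖)) =o[atTop] (fun k : ℕ => 1 / √(k : ℝ))) ∧
    -- cluster points are KKT points whose common cost is the finite limit of the Lagrangians
    (∃ ℓ : ℝ,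
      Tendsto (fun k => ADMM.augLag f g A B b β (x k) (z k) (y k)) atTop (𝓝 (ℓ : EReal)) ∧
      ∀ (x' : EuclideanSpace ℝ (Fin m)) (z' : EuclideanSpace ℝ (Fin n))
        (y' : EuclideanSpace ℝ (Fin p)),
        MapClusterPt (x', z', y') atTop (fun k => (x k, z k, y k)) →
          -(ContinuousLinearMap.adjoint A y') ∈ ADMM.limSubdiff f x' ∧
          -(ContinuousLinearMap.adjoint B y') ∈ ADMM.limSubdiff g z' ∧
          A x' + B z' = b ∧
          f x' + g z' = (ℓ : EReal)) ∧
    -- boundedness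
    (ADMM.LevelBounded (ADMM.totalCost f g A B b) →
      Bornology.IsBounded (Set.range fun k => (A (x k), y k, B (z k))) ∧
      ((∃ (Lf : ℝ) (F : EuclideanSpace ℝ (Fin m) → ℝ),
          (∀ w, f w = (F w : EReal)) ∧ ADMM.IsSmoothWith Lf F) →
        Bornology.IsBounded (Set.range fun k => (x k, y k, z k)))) := by
  obtain ⟨φ, hφ, hL, hσ⟩ := hass.image_smooth
  have hσL := hass.abs_sigma_le
  have hγ := hpar.1
  have hlam := hpar.relaxation_pos
  have hc := hpar.decreaseConst_pos hσL
  have hL0 : 0 ≤ L := (abs_nonneg σ).trans hσL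
  have hβ0 : 0 < β := hβ ▸ one_div_pos.2 hγ
  have hLβ : L ≤ β := by
    rw [hβ, le_div_iff₀ hγ, mul_comm]
    exact (hpar.stepsize_mul_lt_one hσL).le
  have h := ADMM.isTrace_of_steps hass.f_proper hass.g_proper hφ hL hinit hstep
  have hdec := h.lagrangian_succ_le hβ hσL hpar hL hσ
  have hred := h.reduced_le_lagrangian hL hLβ
  obtain ⟨μ, hμ⟩ := hass.exists_lower_bound hφ
  have hC : 0 < ADMM.decreaseConst L σ γ lam * lam ^ 2 / (1 + γ * L) ^ 2 := by positivity
  obtain ⟨⟨l, hl⟩, hsum⟩ := ADMM.tendsto_and_summable_of_decrease hC (fun k => sq_nonneg _) hdec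
    fun k => (hμ _ _ (h.g_eq k)).trans (hred k)
  have hres : Tendsto (fun k => ADMM.residual A B b (x k) (z k)) atTop (𝓝 0) := by
    rw [tendsto_zero_iff_norm_tendsto_zero]
    have h1 := (Real.continuous_sqrt.tendsto 0).comp hsum.tendsto_atTop_zero
    rw [Real.sqrt_zero] at h1
    exact h1.congr fun k => Real.sqrt_sq (norm_nonneg _)
  refine ⟨⟨hc, fun k => ⟨?_, ?_⟩, fun k => ?_, hres, ?_⟩, ⟨l, ?_, fun x' z' y' hcl => ?_⟩,
    fun hlev => ?_⟩
  · rw [h.f_eq]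
    exact EReal.coe_ne_top _
  · rw [h.g_eq]
    exact EReal.coe_ne_top _
  · rw [h.augLag_eq, h.augLag_eq, ← EReal.coe_sub, EReal.coe_le_coe_iff]
    exact hdec k
  · exact ADMM.isLittleO_inf'_of_summable_sq (fun k => norm_nonneg _) hsum
  · simp_rw [h.augLag_eq]
    exact (continuous_coe_real_ereal.tendsto l).comp hl
  · exact h.cluster_isKKT hass.f_lsc hass.g_lsc hφ hL hres hl hcl
  · have hanti : Antitone h.lagrangian := antitone_nat_of_succ_le fun k =>
      (hdec k).trans (sub_le_self _ (by positivity))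
    have hα : ∀ k, h.lagrangian k ≤ h.lagrangian 0 := fun k => hanti (Nat.zero_le k)
    obtain ⟨Rz, hRz⟩ := h.exists_norm_le hlev hφ fun k => (hred k).trans (hα k)
    obtain ⟨Rr, hRr⟩ : ∃ R, ∀ k, ‖ADMM.residual A B b (x k) (z k)‖ ≤ R := by
      obtain ⟨R, hR⟩ := isBounded_iff_forall_norm_le.1 (Metric.isBounded_range_of_tendsto _ hres)
      exact ⟨R, fun k => hR _ ⟨k, rfl⟩⟩
    have hB : ∀ k, ‖B (z k)‖ ≤ ‖B‖ * Rz := fun k =>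
      (B.le_opNorm _).trans (mul_le_mul_of_nonneg_left (hRz k) (norm_nonneg _))
    have hA : ∀ k, ‖A (x k)‖ ≤ Rr + ‖b‖ + ‖B‖ * Rz := fun k => by
      have h1 : A (x k) = ADMM.residual A B b (x k) (z k) + b - B (z k) := by
        rw [ADMM.residual]; abel
      rw [h1]
      exact (norm_sub_le _ _).trans
        (add_le_add ((norm_add_le _ _).trans (add_le_add_left (hRr k) _)) (hB k))
    -- Multipliers are Lipschitz images of the bounded Ax.
    have hy : ∀ k, ‖y k‖ ≤ L * (Rr + ‖b‖ + ‖B‖ * Rz) + ‖gradient φ 0‖ := fun k => by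
      have h1 := hL.2 (A (x k)) 0
      rw [sub_zero] at h1
      rw [h.y_eq, norm_neg, ← sub_add_cancel (gradient φ (A (x k))) (gradient φ 0)]
      exact (norm_add_le _ _).trans (add_le_add_left
        (h1.trans (mul_le_mul_of_nonneg_left (hA k) hL0)) _)
    refine ⟨ADMM.isBounded_range_triple hA hy hB, ?_⟩
    rintro ⟨Lf, F, hF, hLf⟩
    obtain ⟨Rx, hRx⟩ := h.exists_norm_le_of_smooth hβ0.le hass.A_surjective hlev hφ hL hF hLf
      hα hRr
    exact ADMM.isBounded_range_triple hRx hy hRz
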